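/- In $\mathbb R[x,y]$ put $t=xy-1$, $h=t(xt+1)$, $f=(xt+1)^2(t^2+y)$ and $q=-t^2-6th(h+1)$. A \emph{Pinchuk map} is a polynomial map $F=(P,Q):\mathbb R^2\to\mathbb R^2$ with $P=f+h$ and $Q=q-u(f,h)$, where $u$ is a real polynomial in two variables such that the Jacobian determinant satisfies $$P_xQ_y-P_yQ_x=t^2+\bigl(t+f(13+15h)\bigr)^2+f^2 .$$ Theorem. Let $F=(P,Q)$ be any Pinchuk map. Then $F$ is generically two-to-one as a polynomial map of $\mathbb R^2$ to $\mathbb R^2$: there is a nonzero real polynomial $g$ in two variables such that every $w\in\mathbb R^2$ with $g(w)\neq 0$ has exactly two inverse images under $F$ in $\mathbb R^2$. Moreover, let $k$ be $\mathbb R$ or any subfield of $\mathbb R$ that contains all the coefficients of $P$ and $Q$. Then the extension of function fields $k(F)=k(P,Q)\subset k(x,y)$ has degree $6$. Furthermore, the only field automorphism of $k(x,y)$ that fixes every element of $k(F)$ is the identity, and so, in particular, the extension is not Galois. -/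

import Mathlib

noncomputable section

namespace Pinchuk

open MvPolynomial

/-- The auxiliary polynomial `t = x y - 1`, where `x = X 0` and `y = X 1`. -/
def t : MvPolynomial (Fin 2) ℝ := X 0 * X 1 - 1

/-- The auxiliary polynomial `h = t (x t + 1)`. -/
def h : MvPolynomial (Fin 2) ℝ := t * (X 0 * t + 1)

/-- The auxiliary polynomial `f = (x t + 1)² (t² + y)`. -/
def f : MvPolynomial (Fin 2) ℝ := (X 0 * t + 1) ^ 2 * (t ^ 2 + X 1)

/-- The auxiliary polynomial `q = -t² - 6 t h (h + 1)`. -/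
def q : MvPolynomial (Fin 2) ℝ := -t ^ 2 - 6 * t * h * (h + 1)

/-- The Jacobian determinant of a pair of polynomials in two variables. -/
def jacobianDet (F : Fin 2 → MvPolynomial (Fin 2) ℝ) : MvPolynomial (Fin 2) ℝ :=
  (Matrix.of fun i j => pderiv j (F i)).det

/-- `F = (P, Q)` is a Pinchuk map: `P = f + h`, and `Q = q - u(f, h)` for a real polynomial `u`
in two variables, chosen so that the Jacobian determinant is the prescribed sum of squares. -/
structure IsPinchukMap (F : Fin 2 → MvPolynomial (Fin 2) ℝ) : Prop where
  fst_eq : F 0 = f + h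
  snd_eq : ∃ u : MvPolynomial (Fin 2) ℝ, F 1 = q - aeval ![f, h] u
  jacobian_eq : jacobianDet F = t ^ 2 + (t + f * (13 + 15 * h)) ^ 2 + f ^ 2

/-- The polynomial map `ℝ² → ℝ²` given by a pair of real polynomials. -/
def polyMap (F : Fin 2 → MvPolynomial (Fin 2) ℝ) (v : Fin 2 → ℝ) : Fin 2 → ℝ :=
  fun i => eval v (F i)

/-- A polynomial map of the plane is generically two-to-one if all points of the target, except
possibly those on the zero set of some nonzero polynomial, have exactly two inverse images. -/
def GenericallyTwoToOne (F : Fin 2 → MvPolynomial (Fin 2) ℝ) : Prop :=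
  ∃ g : MvPolynomial (Fin 2) ℝ, g ≠ 0 ∧
    ∀ w : Fin 2 → ℝ, eval w g ≠ 0 → {v : Fin 2 → ℝ | polyMap F v = w}.ncard = 2

/-- The coefficients of `F` belong to the subfield `k` of `ℝ`. -/
def DefinedOver (k : Subfield ℝ) (F : Fin 2 → MvPolynomial (Fin 2) ℝ) : Prop :=
  ∀ (i : Fin 2) (m : Fin 2 →₀ ℕ), coeff m (F i) ∈ k

/-- A pair of real polynomials with coefficients in `k`, viewed as polynomials over `k`. -/
def descend {k : Subfield ℝ} {F : Fin 2 → MvPolynomial (Fin 2) ℝ} (hF : DefinedOver k F)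
    (i : Fin 2) : MvPolynomial (Fin 2) k :=
  ∑ m ∈ (F i).support, monomial m ⟨coeff m (F i), hF i m⟩

theorem map_descend {k : Subfield ℝ} {F : Fin 2 → MvPolynomial (Fin 2) ℝ} (hF : DefinedOver k F)
    (i : Fin 2) : MvPolynomial.map k.subtype (descend hF i) = F i := by
  simp only [descend, map_sum, map_monomial]
  exact support_sum_monomial_coeff (F i)

/-- The rational function field `k(X) = k(x, y)`. -/
abbrev FunctionField (k : Subfield ℝ) : Type := FractionRing (MvPolynomial (Fin 2) k)

/-- The subfield `k(F) = k(P, Q)` of `k(x, y)`. -/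
def componentField {k : Subfield ℝ} {F : Fin 2 → MvPolynomial (Fin 2) ℝ}
    (hF : DefinedOver k F) : IntermediateField k (FunctionField k) :=
  IntermediateField.adjoin k
    (Set.range fun i => algebraMap (MvPolynomial (Fin 2) k) (FunctionField k) (descend hF i))

end Pinchuk

end

/-! Everything is read in the coordinates `P` and `s = f`. The relations `f(h - t) = h²(h + 1)`, `x
t² = h - t`, `x y = t + 1` and `h = P - f` recover `t`, `x`, `y` rationally, so `k(x, y) = K(s)`
with `K = k(P)` and `s` transcendental over `K`. The derivation `J(P, ·)` kills `P` and sends `f` to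
`f`, so it acts as `s ∂/∂s`; hence the Jacobian condition fixes `Q` up to a polynomial in `P`. It is
enough to study one second component, scaled to `r` to clear denominators, and the first relation
gives `r s² = N(P, s)` with `N` a sextic in `s` of constant term `-4P⁴(P + 1)²`.

Field theory: `r = N/s²` has degree 6 as a rational function of `s`, so `[K(s) : K(r)] = 6`. Its
poles, `0` of order 2 and `∞` of order 4, have different orders, so an automorphism fixing `r` has
the form `s ↦ μs`. The coefficients of `s⁻²` and `s³` give `μ² = 1 = μ³`, so `μ = 1`.

Real fibres: for fixed `p`, the `s`-derivative of `N/s²` is `4/s` times a positive sum of squares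
(the Jacobian). If `p ≠ 0, -1`, then `N/s²` goes from `-∞` at `0` to `+∞` at both ends, and takes
each value once on each half-line. Off an exceptional curve these two solutions correspond to the
points of the fibre (`exists_point_of_root`, `injOn_fAt`). -/

/-! ### Rational functions of degree six in one variable -/

open Polynomial IntermediateField in
/-- The isomorphism `K(X) ≃ L` given by a transcendental generator of `L` over `K`. -/
noncomputable def RatFunc.algEquivOfAdjoinEqTop {K L : Type*} [Field K] [Field L] [Algebra K L]
    {s : L} (hs : Transcendental K s) (htop : K⟮s⟯ = ⊤) : RatFunc K ≃ₐ[K] L :=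
  ((RatFunc.algEquivOfTranscendental s hs).trans (IntermediateField.equivOfEq htop)).trans
    IntermediateField.topEquiv

open Polynomial IntermediateField in
theorem RatFunc.algEquivOfAdjoinEqTop_algebraMap {K L : Type*} [Field K] [Field L] [Algebra K L]
    {s : L} (hs : Transcendental K s) (htop : K⟮s⟯ = ⊤) (g : K[X]) :
    RatFunc.algEquivOfAdjoinEqTop hs htop (algebraMap K[X] (RatFunc K) g) = aeval s g := by
  simp only [RatFunc.algEquivOfAdjoinEqTop, AlgEquiv.trans_apply,
    RatFunc.algEquivOfTranscendental_algebraMap]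
  exact AdjoinSimple.coe_aeval_gen_apply (F := K) (α := s) g

open Polynomial IntermediateField in
-- Since `M(0) ≠ 0`, the fraction `M / X²` is already reduced.
theorem max_natDegree_num_denom_of_mul_X_sq {K : Type*} [Field K] (ρ : RatFunc K) {M : K[X]}
    (hdeg : M.natDegree = 6) (h0 : M.coeff 0 ≠ 0)
    (hρ : ρ * RatFunc.X ^ 2 = algebraMap K[X] (RatFunc K) M) :
    max ρ.num.natDegree ρ.denom.natDegree = 6 := by
  have hM : M ≠ 0 := by rintro rfl; simp at h0
  have hd := ρ.denom_ne_zero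
  have key : ρ.num * X ^ 2 = M * ρ.denom := by
    apply RatFunc.algebraMap_injective
    rw [map_mul, map_mul, ← hρ, map_pow, RatFunc.algebraMap_X]
    have := RatFunc.num_div_denom ρ
    rw [div_eq_iff (RatFunc.algebraMap_ne_zero hd)] at this
    rw [this]; ring
  have hX : IsCoprime ((X : K[X]) ^ 2) M := by
    apply IsCoprime.pow_left
    rw [Polynomial.irreducible_X.coprime_iff_not_dvd, X_dvd_iff]
    exact h0
  have h1 : ρ.denom ∣ X ^ 2 :=
    (RatFunc.isCoprime_num_denom ρ).symm.dvd_of_dvd_mul_left ⟨M, by rw [key, mul_comm]⟩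
  have h2 : X ^ 2 ∣ ρ.denom := hX.dvd_of_dvd_mul_left ⟨ρ.num, by rw [← key, mul_comm]⟩
  have h3 : ρ.denom.natDegree = 2 := by
    apply le_antisymm
    · simpa using natDegree_le_of_dvd h1 (pow_ne_zero 2 X_ne_zero)
    · simpa using natDegree_le_of_dvd h2 hd
  have hn : ρ.num ≠ 0 := by
    rintro h
    rw [h, zero_mul] at key
    exact mul_ne_zero hM hd key.symm
  have h4 := congrArg natDegree key
  rw [natDegree_mul hn (pow_ne_zero 2 X_ne_zero), natDegree_mul hM hd, hdeg, h3,
    natDegree_X_pow] at h4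
  omega

open Polynomial IntermediateField in
theorem finrank_adjoin_of_mul_sq_eq_aeval {K L : Type*} [Field K] [Field L] [Algebra K L]
    {s r : L} (hs : Transcendental K s) (htop : K⟮s⟯ = ⊤) {M : K[X]}
    (hdeg : M.natDegree = 6) (h0 : M.coeff 0 ≠ 0) (hr : r * s ^ 2 = aeval s M) :
    Module.finrank K⟮r⟯ L = 6 := by
  set e := RatFunc.algEquivOfAdjoinEqTop hs htop with he
  have heX : e RatFunc.X = s := by
    rw [← RatFunc.algebraMap_X, he, RatFunc.algEquivOfAdjoinEqTop_algebraMap, aeval_X]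
  have hρ : e.symm r * RatFunc.X ^ 2 = algebraMap K[X] (RatFunc K) M := by
    apply e.injective
    rw [map_mul, map_pow, heX, e.apply_symm_apply, hr, he,
      RatFunc.algEquivOfAdjoinEqTop_algebraMap]
  rw [← max_natDegree_num_denom_of_mul_X_sq _ hdeg h0 hρ, ← RatFunc.finrank_eq_max_natDegree,
    ← relfinrank_top_right, ← relfinrank_top_right,
    ← IntermediateField.relfinrank_map_map _ _ (e : RatFunc K →ₐ[K] L)]
  congr 1
  · rw [adjoin_map]; simp
  · symm
    rw [← AlgHom.fieldRange_eq_map, AlgHom.fieldRange_eq_top]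
    exact e.surjective

open Polynomial in
theorem Polynomial.isCoprime_right_of_eq_C_mul_pow_add {K : Type*} [Field K] {a b c N : K[X]}
    {m : K} {n : ℕ} (hab : IsCoprime a b) (hm : m ≠ 0) (hN : N = C m * a ^ n + b * c) :
    IsCoprime b N := by
  rw [hN, IsCoprime.add_mul_left_right_iff]
  exact (isCoprime_mul_unit_left_right (isUnit_C.2 hm.isUnit) _ _).2 hab.symm.pow_right

open Polynomial IntermediateField in
-- An endomorphism preserving `r` must respect its poles, of order 2 at `s = 0` and 4 at `s = ∞`.
-- Divisibility in `K[X]` expresses this for `σ s = a/b` in lowest terms.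
theorem algHom_eq_id_of_mul_sq_eq_aeval {K L : Type*} [Field K] [Field L] [Algebra K L]
    {s r : L} (hs : Transcendental K s) (htop : K⟮s⟯ = ⊤)
    {m₀ m₁ m₂ m₃ m₄ m₅ m₆ : K} (h0 : m₀ ≠ 0) (h5 : m₅ ≠ 0) (h6 : m₆ ≠ 0)
    (hr : r * s ^ 2 = aeval s (C m₀ + C m₁ * X + C m₂ * X ^ 2 + C m₃ * X ^ 3 + C m₄ * X ^ 4 +
      C m₅ * X ^ 5 + C m₆ * X ^ 6))
    (σ : L →ₐ[K] L) (hσ : σ r = r) : σ = AlgHom.id K L := by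
  have hinj : Function.Injective (aeval s : K[X] →ₐ[K] L) :=
    transcendental_iff_injective.1 hs
  suffices hσs : σ s = s by
    ext z
    obtain ⟨a, b, rfl⟩ := (mem_adjoin_simple_iff K z).1 (htop ▸ IntermediateField.mem_top)
    rw [map_div₀, ← aeval_algHom_apply, ← aeval_algHom_apply, hσs, AlgHom.id_apply]
  obtain ⟨a, b, hab, hb, hsab⟩ : ∃ a b : K[X], IsCoprime a b ∧ b ≠ 0 ∧
      σ s * aeval s b = aeval s a := by
    set e := RatFunc.algEquivOfAdjoinEqTop hs htop with he
    refine ⟨(e.symm (σ s)).num, (e.symm (σ s)).denom, RatFunc.isCoprime_num_denom _,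
      RatFunc.denom_ne_zero _, ?_⟩
    rw [← RatFunc.algEquivOfAdjoinEqTop_algebraMap hs htop,
      ← RatFunc.algEquivOfAdjoinEqTop_algebraMap hs htop, ← he]
    apply e.symm.injective
    rw [map_mul, e.symm_apply_apply, e.symm_apply_apply]
    generalize e.symm (σ s) = ρ
    exact (eq_div_iff (RatFunc.algebraMap_ne_zero ρ.denom_ne_zero)).1 ρ.num_div_denom.symm
  set M : K[X] := C m₀ + C m₁ * X + C m₂ * X ^ 2 + C m₃ * X ^ 3 + C m₄ * X ^ 4 +
      C m₅ * X ^ 5 + C m₆ * X ^ 6 with hM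
  have hrσ : r * σ s ^ 2 = aeval (σ s) M := by
    rw [aeval_algHom_apply, ← hr, map_mul, map_pow, hσ]
  -- This is `M(s)/s² = M(a/b)/(a/b)²` with denominators cleared. Modulo `b` the second factor on
  -- the right is `m₆ a⁶`, and modulo `a` it is `m₀ b⁶`, so it is coprime to both and `a² b⁴` must
  -- divide `X²`.
  have key : M * (a ^ 2 * b ^ 4) = X ^ 2 * (C m₀ * b ^ 6 + C m₁ * a * b ^ 5 + C m₂ * a ^ 2 * b ^ 4 +
      C m₃ * a ^ 3 * b ^ 3 + C m₄ * a ^ 4 * b ^ 2 + C m₅ * a ^ 5 * b + C m₆ * a ^ 6) := by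
    apply hinj
    have h := congrArg (fun z => z * (aeval s b) ^ 6 * s ^ 2) hrσ
    simp only [hM, map_add, map_mul, map_pow, aeval_C, aeval_X] at h hr ⊢
    rw [← hr, ← hsab]
    linear_combination h
  set N : K[X] := C m₀ * b ^ 6 + C m₁ * a * b ^ 5 + C m₂ * a ^ 2 * b ^ 4 +
      C m₃ * a ^ 3 * b ^ 3 + C m₄ * a ^ 4 * b ^ 2 + C m₅ * a ^ 5 * b + C m₆ * a ^ 6 with hN
  have hbN : IsCoprime b N := isCoprime_right_of_eq_C_mul_pow_add hab h6 (n := 6)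
    (c := C m₀ * b ^ 5 + C m₁ * a * b ^ 4 + C m₂ * a ^ 2 * b ^ 3 +
      C m₃ * a ^ 3 * b ^ 2 + C m₄ * a ^ 4 * b + C m₅ * a ^ 5) (by rw [hN]; ring)
  have haN : IsCoprime a N := isCoprime_right_of_eq_C_mul_pow_add hab.symm h0 (n := 6)
    (c := C m₁ * b ^ 5 + C m₂ * a * b ^ 4 + C m₃ * a ^ 2 * b ^ 3 +
      C m₄ * a ^ 3 * b ^ 2 + C m₅ * a ^ 4 * b + C m₆ * a ^ 5) (by rw [hN]; ring)
  have hdvd : a ^ 2 * b ^ 4 ∣ X ^ 2 :=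
    (IsCoprime.mul_left haN.pow_left hbN.pow_left).dvd_of_dvd_mul_right
      ⟨M, by rw [← key, mul_comm]⟩
  have hdeg := natDegree_le_of_dvd hdvd (pow_ne_zero 2 X_ne_zero)
  have ha : a ≠ 0 := by
    rintro rfl
    simp at hdvd
  rw [natDegree_mul (pow_ne_zero 2 ha) (pow_ne_zero 4 hb), natDegree_pow, natDegree_pow,
    natDegree_X_pow] at hdeg
  obtain ⟨β, rfl⟩ := natDegree_eq_zero.1 (show b.natDegree = 0 by omega)
  obtain ⟨α, α', rfl⟩ := exists_eq_X_add_C_of_natDegree_le_one (show a.natDegree ≤ 1 by omega)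
  have hβ : β ≠ 0 := by simpa using hb
  obtain ⟨μ, ν, hμν⟩ : ∃ μ ν : K, σ s = aeval s (C μ * X + C ν) := by
    refine ⟨α / β, α' / β, ?_⟩
    have hβ' : algebraMap K L β ≠ 0 := by simpa using hβ
    simp only [map_add, map_mul, aeval_C, aeval_X, map_div₀] at hsab ⊢
    field_simp
    linear_combination hsab
  have key2 : M * (C μ * X + C ν) ^ 2 = X ^ 2 * M.comp (C μ * X + C ν) := by
    apply hinj
    have h : r * s ^ 2 * (σ s) ^ 2 = s ^ 2 * aeval (σ s) M := by rw [← hrσ]; ring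
    rw [map_mul, map_mul, map_pow, map_pow, aeval_comp, ← hμν, aeval_X, ← h, hr]
  have hν : ν = 0 := by
    have := congrArg (eval 0) key2
    simpa [hM, h0] using this
  subst hν
  have key3 : M * C μ ^ 2 = M.comp (C μ * X) := by
    have hX : (X : K[X]) ^ 2 ≠ 0 := pow_ne_zero 2 X_ne_zero
    apply mul_left_cancel₀ hX
    rw [map_zero, add_zero] at key2
    rw [← key2]; ring
  have e0 : m₀ * μ ^ 2 = m₀ := by
    have := congrArg (eval 0) key3
    simpa [hM] using this
  have e5 : m₅ * μ ^ 2 = m₅ * μ ^ 5 := by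
    have := congrArg (fun g => coeff g 5) key3
    simp only [comp_C_mul_X_coeff, ← C_pow, coeff_mul_C] at this
    simpa [hM, coeff_X, coeff_C, coeff_X_pow] using this
  -- The constant term gives `μ² = 1`; the odd coefficient `m₅` then excludes `μ = -1`.
  have hμ2 : μ ^ 2 = 1 := by
    apply mul_left_cancel₀ h0; rw [e0, mul_one]
  have hμ : μ = 1 := by
    have := mul_left_cancel₀ h5 e5
    linear_combination (1 - μ - μ ^ 3) * hμ2 - this
  rw [hμν, hμ]
  simp

namespace Pinchuk

/-! ### Pinchuk's polynomials and their relations over any commutative ring -/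

section Values

variable {R : Type*} [CommRing R]

/-- The value of `t` at the point `(x, y)`. -/
def tAt (x y : R) : R := x * y - 1

/-- The value of `h` at the point `(x, y)`. -/
def hAt (x y : R) : R := tAt x y * (x * tAt x y + 1)

/-- The value of `f` at the point `(x, y)`. -/
def fAt (x y : R) : R := (x * tAt x y + 1) ^ 2 * (tAt x y ^ 2 + y)

/-- The value of `P = f + h` at the point `(x, y)`. -/
def pAt (x y : R) : R := fAt x y + hAt x y

/-- Four times Pinchuk's original polynomial `u`. -/
def fourU (a b : R) : R :=
  680 * a * b + 364 * b ^ 2 + 780 * a * b ^ 2 + 276 * b ^ 3 + 300 * a * b ^ 3 + 75 * b ^ 4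

/-- Four times the second component of Pinchuk's original map, at the point `(x, y)`. -/
def rAt (x y : R) : R :=
  4 * (-tAt x y ^ 2 - 6 * tAt x y * hAt x y * (hAt x y + 1)) - fourU (fAt x y) (hAt x y)

/-- The numerator of the second component as a rational function of `s = f` for fixed `p`. -/
def numAt (p s : R) : R :=
  -4 * p ^ 4 * (p + 1) ^ 2 + 48 * p ^ 3 * (p + 1) ^ 2 * s
    - (512 * p ^ 2 + 604 * p ^ 3 + 255 * p ^ 4) * s ^ 2
    + (216 * p + 536 * p ^ 2 + 320 * p ^ 3) * s ^ 3 + (252 + 396 * p + 150 * p ^ 2) * s ^ 4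
    - (416 + 456 * p) * s ^ 5 + 197 * s ^ 6

theorem fAt_mul_hAt_sub_tAt (x y : R) :
    fAt x y * (hAt x y - tAt x y) = hAt x y ^ 2 * (hAt x y + 1) := by
  simp only [fAt, hAt, tAt]; ring

theorem mul_tAt_sq (x y : R) : x * tAt x y ^ 2 = hAt x y - tAt x y := by
  simp only [hAt]; ring

theorem mul_eq_tAt_add_one (x y : R) : x * y = tAt x y + 1 := by
  simp only [tAt]; ring

/-- The second component in terms of `s = f`, `p` and `τ = t` subject to the basic relation. -/
theorem mul_sq_eq_numAt {p s τ : R} (hτ : s * (p - s - τ) = (p - s) ^ 2 * (p - s + 1)) :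
    (4 * (-τ ^ 2 - 6 * τ * (p - s) * (p - s + 1)) - fourU s (p - s)) * s ^ 2 = numAt p s := by
  have h : s * τ = s * (p - s) - (p - s) ^ 2 * (p - s + 1) := by linear_combination -hτ
  have e : (4 * (-τ ^ 2 - 6 * τ * (p - s) * (p - s + 1)) - fourU s (p - s)) * s ^ 2 =
      4 * (-(s * τ) ^ 2 - 6 * (s * τ) * s * (p - s) * (p - s + 1)) - fourU s (p - s) * s ^ 2 := by
    ring
  rw [e, h]
  simp only [fourU, numAt]; ring

theorem rAt_mul_sq (x y : R) : rAt x y * fAt x y ^ 2 = numAt (pAt x y) (fAt x y) := by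
  have e : hAt x y = pAt x y - fAt x y := by simp only [pAt]; ring
  have := fAt_mul_hAt_sub_tAt x y
  rw [e] at this
  rw [← mul_sq_eq_numAt this, ← e]
  rfl

variable {S : Type*} [CommRing S] (φ : R →+* S) (x y : R)

theorem map_tAt : φ (tAt x y) = tAt (φ x) (φ y) := by simp [tAt]

theorem map_hAt : φ (hAt x y) = hAt (φ x) (φ y) := by simp [hAt, map_tAt]

theorem map_fAt : φ (fAt x y) = fAt (φ x) (φ y) := by simp [fAt, map_tAt]

theorem map_pAt : φ (pAt x y) = pAt (φ x) (φ y) := by simp [pAt, map_fAt, map_hAt]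

theorem map_fourU : φ (fourU x y) = fourU (φ x) (φ y) := by simp [fourU, map_ofNat]

theorem map_rAt : φ (rAt x y) = rAt (φ x) (φ y) := by
  simp [rAt, map_fAt, map_hAt, map_tAt, map_fourU, map_ofNat]

end Values

/-! ### The function field as `k(P)(f)` -/

section FractionField

open MvPolynomial IntermediateField

variable (k : Type*) [Field k]

/-- The polynomial `P = f + h` over `k`. -/
noncomputable def pPoly : MvPolynomial (Fin 2) k := pAt (X 0) (X 1)

/-- The polynomial `f` over `k`. -/
noncomputable def fPoly : MvPolynomial (Fin 2) k := fAt (X 0) (X 1)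

/-- Four times the second component of Pinchuk's original map, over `k`. -/
noncomputable def rPoly : MvPolynomial (Fin 2) k := rAt (X 0) (X 1)

local notation "𝕃" => FractionRing (MvPolynomial (Fin 2) k)

/-- The inclusion of the polynomial ring into its fraction field. -/
noncomputable abbrev toFrac : MvPolynomial (Fin 2) k →ₐ[k] 𝕃 :=
  IsScalarTower.toAlgHom k _ _

theorem toFrac_injective : Function.Injective (toFrac k) :=
  IsFractionRing.injective (MvPolynomial (Fin 2) k) 𝕃

/-- Restriction of polynomials to the line `x = 0`. -/
noncomputable abbrev restrictLine : MvPolynomial (Fin 2) k →ₐ[k] Polynomial k :=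
  aeval ![0, Polynomial.X]

/-- On `x = 0` one has `t = h = -1` and `f = y + 1`. Besides transcendence of `P`, this later lets
polynomials in `P` be read off from their restriction. -/
theorem restrictLine_pPoly : restrictLine k (pPoly k) = Polynomial.X := by
  have := map_pAt (restrictLine k : MvPolynomial (Fin 2) k →+* Polynomial k) (X 0) (X 1)
  simp only [RingHom.coe_coe] at this
  rw [pPoly, this]
  simp [pAt, fAt, hAt, tAt]

theorem transcendental_pPoly : Transcendental k (pPoly k) := by
  have h : Transcendental k (restrictLine k (pPoly k)) := by
    rw [restrictLine_pPoly]; exact Polynomial.transcendental_X k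
  exact fun hp => h (hp.algHom _)

theorem transcendental_toFrac_pPoly : Transcendental k (toFrac k (pPoly k)) := by
  exact fun h => transcendental_pPoly k ((isAlgebraic_algHom_iff _ (toFrac_injective k)).1 h)

theorem fPoly_ne_zero [CharZero k] : fPoly k ≠ 0 := by
  intro h
  have := congrArg (eval ![0, 1]) h
  rw [fPoly, map_fAt] at this
  norm_num [fAt, tAt] at this

variable {k} in
theorem eq_top_of_X_mem {E : IntermediateField k 𝕃} (h0 : toFrac k (X 0) ∈ E)
    (h1 : toFrac k (X 1) ∈ E) : E = ⊤ := by
  have hpoly (g : MvPolynomial (Fin 2) k) : toFrac k g ∈ E := by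
    induction g using MvPolynomial.induction_on with
    | C a => exact E.algebraMap_mem a
    | add a b ha hb => rw [map_add]; exact E.add_mem ha hb
    | mul_X a i ha =>
      rw [map_mul]
      refine E.mul_mem ha ?_
      fin_cases i
      exacts [h0, h1]
  rw [eq_top_iff]
  intro z _
  obtain ⟨a, b, -, rfl⟩ := IsFractionRing.div_surjective (A := MvPolynomial (Fin 2) k) z
  exact E.div_mem (hpoly a) (hpoly b)

/-- The generators are recovered in the order `h = P - f`, then `t`, `x` and `y`, each from a
relation linear in it. -/
theorem adjoin_fPoly_eq_top [CharZero k] :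
    (k⟮toFrac k (pPoly k)⟯)⟮toFrac k (fPoly k)⟯ = ⊤ := by
  set E := (k⟮toFrac k (pPoly k)⟯)⟮toFrac k (fPoly k)⟯ with hE
  have hfE : toFrac k (fPoly k) ∈ E := mem_adjoin_simple_self _ _
  have hpE : toFrac k (pPoly k) ∈ E :=
    E.algebraMap_mem ⟨_, mem_adjoin_simple_self k (toFrac k (pPoly k))⟩
  suffices h : E.restrictScalars k = ⊤ by
    rwa [restrictScalars_eq_top_iff] at h
  have hinj := toFrac_injective k
  set x : MvPolynomial (Fin 2) k := X 0 with hx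
  set y : MvPolynomial (Fin 2) k := X 1 with hy
  have hhE : toFrac k (hAt x y) ∈ E := by
    have : hAt x y = pPoly k - fPoly k := by simp only [pPoly, fPoly, pAt, hx, hy]; ring
    rw [this, map_sub]
    exact E.sub_mem hpE hfE
  have htE : toFrac k (tAt x y) ∈ E := by
    have h0 : toFrac k (fPoly k) ≠ 0 := (map_ne_zero_iff _ hinj).2 (fPoly_ne_zero k)
    have h1 := congrArg (toFrac k) (fAt_mul_hAt_sub_tAt x y)
    rw [map_mul, map_sub] at h1
    have h2 : toFrac k (tAt x y) =
        toFrac k (hAt x y) - toFrac k (hAt x y ^ 2 * (hAt x y + 1)) / toFrac k (fPoly k) := by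
      rw [← h1]
      change _ = _ - toFrac k (fPoly k) * _ / _
      field_simp
      ring
    rw [h2]
    refine E.sub_mem hhE (E.div_mem ?_ hfE)
    simp only [map_mul, map_pow, map_add, map_one]
    exact E.mul_mem (E.pow_mem hhE 2) (E.add_mem hhE E.one_mem)
  have hxE : toFrac k x ∈ E := by
    have h0 : toFrac k (tAt x y) ≠ 0 := by
      refine (map_ne_zero_iff _ hinj).2 fun h => ?_
      have := congrArg (eval 0) h
      simp [tAt, hx] at this
    have h1 := congrArg (toFrac k) (mul_tAt_sq x y)
    rw [map_mul, map_pow, map_sub, ← eq_div_iff (pow_ne_zero 2 h0)] at h1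
    rw [h1]
    exact E.div_mem (E.sub_mem hhE htE) (E.pow_mem htE 2)
  have hyE : toFrac k y ∈ E := by
    have h0 : toFrac k x ≠ 0 := (map_ne_zero_iff _ hinj).2 (X_ne_zero 0)
    have h1 := congrArg (toFrac k) (mul_eq_tAt_add_one x y)
    rw [map_mul, map_add, map_one, mul_comm, ← eq_div_iff h0] at h1
    rw [h1]
    exact E.div_mem (E.add_mem htE E.one_mem) hxE
  exact eq_top_of_X_mem hxE hyE

open algebraAdjoinAdjoin in
-- Otherwise `k(x, y)` would be algebraic over `k(P)`, of transcendence degree at most 1 instead of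
-- 2.
theorem transcendental_toFrac_fPoly [CharZero k] :
    Transcendental k⟮toFrac k (pPoly k)⟯ (toFrac k (fPoly k)) := by
  intro halg
  set K := k⟮toFrac k (pPoly k)⟯ with hK
  have h1 : Algebra.IsAlgebraic K 𝕃 := by
    have h2 := isAlgebraic_adjoin_simple halg.isIntegral
    rw [adjoin_fPoly_eq_top] at h2
    exact topEquiv.isAlgebraic
  have h3 : Algebra.IsAlgebraic (Algebra.adjoin k {toFrac k (pPoly k)}) 𝕃 :=
    (IsFractionRing.comap_isAlgebraic_iff (K := k⟮toFrac k (pPoly k)⟯)).2 h1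
  have h4 := Algebra.IsAlgebraic.trdeg_le_cardinalMk k (A := 𝕃) {toFrac k (pPoly k)}
  have h5 := trdeg_le_of_injective (toFrac k) (toFrac_injective k)
  rw [MvPolynomial.trdeg_of_isDomain] at h5
  have h6 := h5.trans h4
  simp at h6

end FractionField

end Pinchuk

/-! ### The Jacobian condition determines `Q` up to a polynomial in `P` -/

namespace Pinchuk

open Polynomial IntermediateField in
theorem aevalAeval_pPoly_fPoly_injective (k : Type*) [Field k] [CharZero k] :
    Function.Injective (aevalAeval (R := k) (pPoly k) (fPoly k)) := by
  rw [injective_iff_map_eq_zero]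
  intro G hG
  set K := k⟮toFrac k (pPoly k)⟯ with hK
  set ψ : k[X] →ₐ[k] K := aeval (AdjoinSimple.gen k (toFrac k (pPoly k))) with hψ
  have hψinj : Function.Injective ψ := by
    rw [injective_iff_map_eq_zero]
    intro g hg
    apply (transcendental_iff.1 (transcendental_toFrac_pPoly k)) g
    rw [← AdjoinSimple.coe_aeval_gen_apply, ← hψ, hg]
    rfl
  have hev : toFrac k (aevalAeval (pPoly k) (fPoly k) G) =
      aeval (toFrac k (fPoly k)) (G.map (ψ : k[X] →+* K)) := by
    clear hG
    induction G using Polynomial.induction_on' with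
    | add a b ha hb => simp only [map_add, Polynomial.map_add, ha, hb]
    | monomial n a =>
      rw [← C_mul_X_pow_eq_monomial, map_mul, map_pow, aevalAeval_C, aevalAeval_Y, map_mul, map_pow,
        Polynomial.map_mul, Polynomial.map_pow, map_X, map_C, map_mul, map_pow, aeval_X, aeval_C,
        ← aeval_algHom_apply]
      congr 1
      exact (AdjoinSimple.coe_aeval_gen_apply (F := k) (α := toFrac k (pPoly k)) a).symm
  rw [hG, map_zero] at hev
  have := (transcendental_iff.1 (transcendental_toFrac_fPoly k)) _ hev.symm
  exact (Polynomial.map_eq_zero_iff hψinj).1 this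

theorem derivation_ofNat {R A : Type*} [CommRing R] [CommRing A] [Algebra R A]
    (D : Derivation R A A) (n : ℕ) [n.AtLeastTwo] : D (OfNat.ofNat n) = 0 :=
  D.map_natCast n

section Jacobian

open MvPolynomial

/-- The derivation `g ↦ J(P, g)`. -/
noncomputable def jacDer : Derivation ℝ (MvPolynomial (Fin 2) ℝ) (MvPolynomial (Fin 2) ℝ) :=
  pderiv 0 (pPoly ℝ) • pderiv 1 - pderiv 1 (pPoly ℝ) • pderiv 0

theorem jacDer_apply (g : MvPolynomial (Fin 2) ℝ) :
    jacDer g = pderiv 0 (pPoly ℝ) * pderiv 1 g - pderiv 1 (pPoly ℝ) * pderiv 0 g := by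
  simp [jacDer]

theorem jacobianDet_eq_jacDer {F : Fin 2 → MvPolynomial (Fin 2) ℝ} (h0 : F 0 = pPoly ℝ) :
    jacobianDet F = jacDer (F 1) := by
  simp [jacobianDet, Matrix.det_fin_two, jacDer_apply, h0]

theorem f_add_h_eq : f + h = pPoly ℝ := rfl

theorem f_eq : f = fPoly ℝ := rfl

theorem jacDer_pPoly : jacDer (pPoly ℝ) = 0 := by
  rw [jacDer_apply]; ring

/-- Together with `jacDer_pPoly`, this makes `J(P, ·)` act on `ℝ[P, f]` as `f ∂/∂f`. -/
theorem jacDer_f : jacDer f = f := by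
  rw [jacDer_apply, ← f_add_h_eq]
  simp only [f, h, t, map_add, map_sub, Derivation.leibniz, Derivation.leibniz_pow, pderiv_X_self,
    pderiv_X_of_ne (show (1 : Fin 2) ≠ 0 by decide), pderiv_X_of_ne (show (0 : Fin 2) ≠ 1 by decide),
    pderiv_one, smul_eq_mul, nsmul_eq_mul]
  push_cast
  ring

theorem jacDer_h : jacDer h = -f := by
  have := jacDer_pPoly
  rw [← f_add_h_eq, map_add, jacDer_f] at this
  linear_combination this

theorem f_mul_h_sub_t : f * (h - t) = h ^ 2 * (h + 1) := fAt_mul_hAt_sub_tAt _ _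

/-- Differentiate `f(h - t) = h²(h + 1)` and cancel `f`. -/
theorem jacDer_t : jacDer t = 3 * h ^ 2 + 3 * h - t - f := by
  have h1 := congrArg jacDer f_mul_h_sub_t
  simp only [Derivation.leibniz, Derivation.leibniz_pow, map_add, map_sub, jacDer_f, jacDer_h,
    smul_eq_mul, nsmul_eq_mul, Derivation.map_one_eq_zero] at h1
  push_cast at h1
  apply mul_left_cancel₀ (f_eq ▸ fPoly_ne_zero ℝ : f ≠ 0)
  linear_combination -h1

theorem rPoly_eq : rPoly ℝ = 4 * q - fourU f h := by
  simp only [q]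
  change 4 * (-t ^ 2 - 6 * t * h * (h + 1)) - fourU f h = _
  ring

theorem jacDer_rPoly :
    jacDer (rPoly ℝ) = 4 * (t ^ 2 + (t + f * (13 + 15 * h)) ^ 2 + f ^ 2) := by
  rw [rPoly_eq]
  simp only [q, fourU, Derivation.leibniz, Derivation.leibniz_pow, map_add, map_sub, map_neg,
    jacDer_f, jacDer_h, jacDer_t, smul_eq_mul, nsmul_eq_mul, Derivation.map_one_eq_zero,
    derivation_ofNat _ 4, derivation_ofNat _ 6, derivation_ofNat _ 680, derivation_ofNat _ 364,
    derivation_ofNat _ 780, derivation_ofNat _ 276, derivation_ofNat _ 300, derivation_ofNat _ 75]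
  push_cast
  -- Both sides are now polynomials in `f`, `h`, `t`, equal only modulo the basic relation.
  linear_combination (72 * (h + 1)) * f_mul_h_sub_t

open Polynomial in
theorem jacDer_aevalAeval (G : ℝ[X][X]) :
    jacDer (aevalAeval (pPoly ℝ) (fPoly ℝ) G) =
      aevalAeval (pPoly ℝ) (fPoly ℝ) (derivative G) * fPoly ℝ := by
  have hf : jacDer (fPoly ℝ) = fPoly ℝ := jacDer_f
  induction G using Polynomial.induction_on' with
  | add a b ha hb => simp only [map_add, ha, hb, add_mul]
  | monomial n a =>
    rw [← Polynomial.C_mul_X_pow_eq_monomial, derivative_C_mul, derivative_X_pow]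
    simp only [map_mul, map_pow, aevalAeval_C, aevalAeval_Y, map_natCast, Derivation.leibniz,
      Derivation.leibniz_pow, Derivation.map_aeval, jacDer_pPoly, hf, smul_eq_mul, nsmul_eq_mul]
    ring

open Polynomial in
-- The difference `4Q - r` lies in `ℝ[f, h] = ℝ[P, f]` and has zero Jacobian with `P`, so its
-- `f`-derivative vanishes.
theorem exists_polynomial_of_isPinchukMap {F : Fin 2 → MvPolynomial (Fin 2) ℝ}
    (hF : IsPinchukMap F) : ∃ v : ℝ[X], 4 * F 1 = rPoly ℝ + aeval (pPoly ℝ) v := by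
  obtain ⟨u, hu⟩ := hF.snd_eq
  have hjac := hF.jacobian_eq
  rw [jacobianDet_eq_jacDer hF.fst_eq] at hjac
  set w : MvPolynomial (Fin 2) ℝ := fourU (MvPolynomial.X 0) (MvPolynomial.X 1) - 4 * u with hw
  -- The inner variable stands for `P` and the outer one for `f`, so `h` becomes `C X - X`.
  set G : ℝ[X][X] := MvPolynomial.aeval ![Polynomial.X, Polynomial.C Polynomial.X - Polynomial.X] w with hG
  have hW : aevalAeval (pPoly ℝ) (fPoly ℝ) G = 4 * F 1 - rPoly ℝ := by
    have h1 : aevalAeval (pPoly ℝ) (fPoly ℝ) G = MvPolynomial.aeval ![f, h] w := by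
      rw [hG]
      change ((aevalAeval (R := ℝ) (pPoly ℝ) (fPoly ℝ)).comp
        (MvPolynomial.aeval ![Polynomial.X, Polynomial.C Polynomial.X - Polynomial.X])) w = _
      congr 1
      ext i : 1
      fin_cases i
      · simp [f_eq]
      · simp [← f_add_h_eq, ← f_eq]
    have h2 := map_fourU ((MvPolynomial.aeval ![f, h] :
      MvPolynomial (Fin 2) ℝ →ₐ[ℝ] MvPolynomial (Fin 2) ℝ) :
      MvPolynomial (Fin 2) ℝ →+* MvPolynomial (Fin 2) ℝ)
      (MvPolynomial.X 0) (MvPolynomial.X 1)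
    simp only [RingHom.coe_coe, MvPolynomial.aeval_X, Matrix.cons_val_zero, Matrix.cons_val_one]
      at h2
    rw [h1, hw, hu, rPoly_eq, map_sub, h2, map_mul, map_ofNat]
    ring
  have hD : jacDer (4 * F 1 - rPoly ℝ) = 0 := by
    rw [map_sub, jacDer_rPoly, Derivation.leibniz, hjac, derivation_ofNat _ 4]
    simp
  rw [← hW, jacDer_aevalAeval] at hD
  have hG' : derivative G = 0 := by
    apply aevalAeval_pPoly_fPoly_injective ℝ
    rw [map_zero]
    exact (mul_eq_zero.1 hD).resolve_right (fPoly_ne_zero ℝ)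
  refine ⟨G.coeff 0, ?_⟩
  rw [eq_C_of_derivative_eq_zero hG', aevalAeval_C] at hW
  linear_combination -hW

end Jacobian

end Pinchuk

/-! ### Degree and automorphisms for Pinchuk's original map -/

namespace Pinchuk

open IntermediateField

theorem ringHom_eq_id_of_fixes_adjoin_simple {K L : Type*} [Field K] [Field L] [Algebra K L] {r : L}
    (hr : ∀ σ : L →ₐ[K] L, σ r = r → σ = AlgHom.id K L) (σ : L →+* L)
    (hσ : ∀ z ∈ K⟮r⟯, σ z = z) : σ = RingHom.id L := by
  have hτ := hr { σ with commutes' := fun a => hσ _ (IntermediateField.algebraMap_mem _ a) }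
    (hσ _ (mem_adjoin_simple_self _ _))
  ext z
  exact DFunLike.congr_fun hτ z

section Generic

variable (k : Type*) [Field k]

open Polynomial in
/-- The field-theoretic part of the theorem for Pinchuk's original map over a field `k`. -/
theorem finrank_and_algHom_eq_id [CharZero k] :
    Module.finrank (k⟮toFrac k (pPoly k)⟯)⟮toFrac k (rPoly k)⟯
      (FractionRing (MvPolynomial (Fin 2) k)) = 6 ∧
    ∀ σ : FractionRing (MvPolynomial (Fin 2) k) →ₐ[k⟮toFrac k (pPoly k)⟯]
        FractionRing (MvPolynomial (Fin 2) k),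
      σ (toFrac k (rPoly k)) = toFrac k (rPoly k) → σ = AlgHom.id _ _ := by
  have hs := transcendental_toFrac_fPoly k
  have htop := adjoin_fPoly_eq_top k
  set p : k⟮toFrac k (pPoly k)⟯ := AdjoinSimple.gen k (toFrac k (pPoly k)) with hp
  have hpcoe : algebraMap k⟮toFrac k (pPoly k)⟯ (FractionRing (MvPolynomial (Fin 2) k)) p =
      toFrac k (pPoly k) := rfl
  -- As `P` is transcendental, it avoids the constants `0`, `-1` and `-416/456` at which the
  -- required coefficients vanish.
  have hpc (c : k) : p ≠ algebraMap k _ c := by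
    intro h
    apply transcendental_toFrac_pPoly k
    rw [← hpcoe, h, ← IsScalarTower.algebraMap_apply]
    exact isAlgebraic_algebraMap c
  have : CharZero k⟮toFrac k (pPoly k)⟯ :=
    charZero_of_injective_algebraMap (algebraMap k k⟮toFrac k (pPoly k)⟯).injective
  have h0 : -4 * p ^ 4 * (p + 1) ^ 2 ≠ 0 := by
    refine mul_ne_zero (mul_ne_zero (by norm_num) (pow_ne_zero 4 ?_)) (pow_ne_zero 2 ?_)
    · rw [← map_zero (algebraMap k _)]; exact hpc 0
    · intro h
      refine hpc (-1) ?_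
      rw [map_neg, map_one]
      linear_combination h
  have h5 : -(416 + 456 * p) ≠ 0 := by
    intro h
    refine hpc (-416 / 456) ?_
    rw [map_div₀, map_neg, map_ofNat, map_ofNat, eq_div_iff (by norm_num)]
    linear_combination -h
  have h6 : (197 : k⟮toFrac k (pPoly k)⟯) ≠ 0 := by norm_num
  have hr : toFrac k (rPoly k) * toFrac k (fPoly k) ^ 2 = aeval (toFrac k (fPoly k))
      (C (-4 * p ^ 4 * (p + 1) ^ 2) + C (48 * p ^ 3 * (p + 1) ^ 2) * X
        + C (-(512 * p ^ 2 + 604 * p ^ 3 + 255 * p ^ 4)) * X ^ 2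
        + C (216 * p + 536 * p ^ 2 + 320 * p ^ 3) * X ^ 3
        + C (252 + 396 * p + 150 * p ^ 2) * X ^ 4 + C (-(416 + 456 * p)) * X ^ 5
        + C 197 * X ^ 6) := by
    have h1 := congrArg (toFrac k) (rAt_mul_sq (MvPolynomial.X 0 : MvPolynomial (Fin 2) k)
      (MvPolynomial.X 1))
    rw [map_mul, map_pow] at h1
    refine h1.trans ?_
    change toFrac k (numAt (pPoly k) (fPoly k)) = _
    simp only [numAt, map_add, map_sub, map_mul, map_pow, map_neg, aeval_C, aeval_X, map_ofNat,
      map_one, hpcoe]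
    ring
  refine ⟨finrank_adjoin_of_mul_sq_eq_aeval hs htop ?_ ?_ hr,
    fun σ hσ => algHom_eq_id_of_mul_sq_eq_aeval hs htop h0 h5 h6 hr σ hσ⟩
  · compute_degree!
  · rw [coeff_zero_eq_eval_zero]
    convert! h0 using 1
    simp only [eval_add, eval_mul, eval_pow, eval_C, eval_X]
    ring

/-- The field generated by the components of Pinchuk's original map. -/
noncomputable def originalField : IntermediateField k (FractionRing (MvPolynomial (Fin 2) k)) :=
  k⟮toFrac k (pPoly k), toFrac k (rPoly k)⟯

theorem originalField_eq_restrictScalars :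
    originalField k = ((k⟮toFrac k (pPoly k)⟯)⟮toFrac k (rPoly k)⟯).restrictScalars k := by
  rw [adjoin_simple_adjoin_simple, originalField]

theorem finrank_originalField [CharZero k] :
    Module.finrank (originalField k) (FractionRing (MvPolynomial (Fin 2) k)) = 6 := by
  rw [originalField_eq_restrictScalars]
  exact (finrank_and_algHom_eq_id k).1

theorem ringHom_eq_id_of_fixes_originalField [CharZero k]
    (σ : FractionRing (MvPolynomial (Fin 2) k) →+* FractionRing (MvPolynomial (Fin 2) k))
    (hσ : ∀ z ∈ originalField k, σ z = z) : σ = RingHom.id _ := by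
  rw [originalField_eq_restrictScalars] at hσ
  exact ringHom_eq_id_of_fixes_adjoin_simple (finrank_and_algHom_eq_id k).2 σ hσ

end Generic

/-! ### Passage to an arbitrary Pinchuk map over `k` -/

section Descent

variable {F : Fin 2 → MvPolynomial (Fin 2) ℝ} {k : Subfield ℝ}

theorem map_subtype_pPoly (k : Subfield ℝ) :
    MvPolynomial.map k.subtype (pPoly k) = pPoly ℝ := by
  rw [pPoly, map_pAt, MvPolynomial.map_X, MvPolynomial.map_X, pPoly]

theorem map_subtype_rPoly (k : Subfield ℝ) :
    MvPolynomial.map k.subtype (rPoly k) = rPoly ℝ := by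
  rw [rPoly, map_rAt, MvPolynomial.map_X, MvPolynomial.map_X, rPoly]

theorem map_subtype_injective (k : Subfield ℝ) :
    Function.Injective (MvPolynomial.map (σ := Fin 2) k.subtype) :=
  MvPolynomial.map_injective _ k.subtype_injective

theorem descend_zero (hF : IsPinchukMap F) (hk : DefinedOver k F) : descend hk 0 = pPoly k := by
  apply map_subtype_injective k
  rw [map_descend, map_subtype_pPoly, hF.fst_eq, f_add_h_eq]

theorem map_subtype_aeval (k : Subfield ℝ) (g : MvPolynomial (Fin 2) k) (v : Polynomial k) :
    MvPolynomial.map k.subtype (Polynomial.aeval g v) =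
      Polynomial.aeval (MvPolynomial.map k.subtype g) (v.map k.subtype) := by
  rw [Polynomial.aeval_def, Polynomial.hom_eval₂, Polynomial.aeval_def, Polynomial.eval₂_map]
  congr 1
  ext
  simp

theorem map_subtype_restrictLine (k : Subfield ℝ) (g : MvPolynomial (Fin 2) k) :
    (restrictLine k g).map k.subtype = restrictLine ℝ (MvPolynomial.map k.subtype g) := by
  induction g using MvPolynomial.induction_on with
  | C a => simp
  | add a b ha hb => simp only [map_add, Polynomial.map_add, ha, hb]
  | mul_X a i ha =>
    rw [map_mul, Polynomial.map_mul, ha, map_mul, map_mul, MvPolynomial.map_X]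
    fin_cases i <;> simp

/-- A priori the polynomial in `P` has real coefficients. Restriction to `x = 0` turns `P` into the
coordinate, so it exhibits that polynomial as the restriction of one over `k`. -/
theorem exists_descend_one (hF : IsPinchukMap F) (hk : DefinedOver k F) :
    ∃ v : Polynomial k, 4 * descend hk 1 = rPoly k + Polynomial.aeval (pPoly k) v := by
  obtain ⟨v, hv⟩ := exists_polynomial_of_isPinchukMap hF
  refine ⟨restrictLine k (4 * descend hk 1 - rPoly k), ?_⟩
  apply map_subtype_injective k
  have h1 : MvPolynomial.map k.subtype (4 * descend hk 1 - rPoly k) =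
      Polynomial.aeval (pPoly ℝ) v := by
    rw [map_sub, map_mul, map_ofNat, map_descend, map_subtype_rPoly, hv]; ring
  rw [map_add, map_subtype_aeval, map_subtype_restrictLine, h1, ← Polynomial.aeval_algHom_apply,
    restrictLine_pPoly, Polynomial.aeval_X_left_apply, map_subtype_pPoly, ← h1, ← map_add]
  congr 1
  ring

theorem componentField_eq (hF : IsPinchukMap F) (hk : DefinedOver k F) :
    componentField hk = originalField k := by
  rw [originalField, componentField]
  obtain ⟨v, hv⟩ := exists_descend_one hF hk
  have hv' : 4 * toFrac k (descend hk 1) =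
      toFrac k (rPoly k) + Polynomial.aeval (toFrac k (pPoly k)) v := by
    have := congrArg (toFrac k) hv
    rwa [map_mul, map_ofNat, map_add, ← Polynomial.aeval_algHom_apply] at this
  have haeval (E : IntermediateField k (FunctionField k)) (hE : toFrac k (pPoly k) ∈ E) :
      Polynomial.aeval (toFrac k (pPoly k)) v ∈ E :=
    Algebra.adjoin_le (S := E.toSubalgebra) (by simpa using hE)
      (Polynomial.aeval_mem_adjoin_singleton k _)
  apply le_antisymm
  · rw [adjoin_le_iff]
    have hp : toFrac k (pPoly k) ∈ k⟮toFrac k (pPoly k), toFrac k (rPoly k)⟯ :=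
      subset_adjoin _ _ (by simp)
    have hr : toFrac k (rPoly k) ∈ k⟮toFrac k (pPoly k), toFrac k (rPoly k)⟯ :=
      subset_adjoin _ _ (by simp)
    rintro _ ⟨i, rfl⟩
    fin_cases i
    · change toFrac k (descend hk 0) ∈ _
      rwa [descend_zero hF]
    · change toFrac k (descend hk 1) ∈ _
      have : toFrac k (descend hk 1) =
          (toFrac k (rPoly k) + Polynomial.aeval (toFrac k (pPoly k)) v) / 4 := by
        rw [← hv']; field_simp
      rw [this]
      exact div_mem (add_mem hr (haeval _ hp)) (ofNat_mem _ 4)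
  · have h0 : toFrac k (descend hk 0) ∈ componentField hk := subset_adjoin _ _ ⟨0, rfl⟩
    have h1 : toFrac k (descend hk 1) ∈ componentField hk := subset_adjoin _ _ ⟨1, rfl⟩
    rw [descend_zero hF] at h0
    rw [adjoin_le_iff]
    rintro _ (rfl | rfl)
    · exact h0
    · rw [← sub_eq_iff_eq_add] at hv'
      rw [← hv']
      exact sub_mem (mul_mem (ofNat_mem _ 4) h1) (haeval _ h0)

theorem finrank_componentField (hF : IsPinchukMap F) (hk : DefinedOver k F) :
    Module.finrank (componentField hk) (FunctionField k) = 6 := by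
  rw [componentField_eq hF hk]
  exact finrank_originalField k

theorem algEquiv_componentField_eq_refl (hF : IsPinchukMap F) (hk : DefinedOver k F)
    (σ : FunctionField k ≃ₐ[componentField hk] FunctionField k) : σ = AlgEquiv.refl := by
  have h := ringHom_eq_id_of_fixes_originalField k (σ : FunctionField k →+* FunctionField k)
    fun z hz => σ.commutes ⟨z, componentField_eq hF hk ▸ hz⟩
  ext z
  exact RingHom.congr_fun h z

theorem not_isGalois_componentField (hF : IsPinchukMap F) (hk : DefinedOver k F) :
    ¬ IsGalois (componentField hk) (FunctionField k) := by
  intro hG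
  have h6 := finrank_componentField hF hk
  have : FiniteDimensional (componentField hk) (FunctionField k) :=
    Module.finite_of_finrank_pos (by rw [h6]; norm_num)
  have hcard := IsGalois.card_aut_eq_finrank (componentField hk) (FunctionField k)
  have : Subsingleton (FunctionField k ≃ₐ[componentField hk] FunctionField k) :=
    ⟨fun a b => (algEquiv_componentField_eq_refl hF hk a).trans
      (algEquiv_componentField_eq_refl hF hk b).symm⟩
  rw [h6, Nat.card_of_subsingleton AlgEquiv.refl] at hcard
  norm_num at hcard

end Descent

end Pinchuk

namespace Pinchuk

/-! ### The exceptional curve in the target plane -/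

section Exceptional

variable {R : Type*} [CommRing R]

/-- The factor of the exceptional polynomial that vanishes on the image of the curve `t = 0`. -/
def tFactor (p ρ : R) : R :=
  (ρ + (-45 * p ^ 2 - 208 * p)) ^ 2
    - 2 * (300 * p ^ 2 + 716 * p + 416) * (ρ + (-45 * p ^ 2 - 208 * p))
    - (300 * p ^ 2 + 716 * p + 416) ^ 2 * p

/-- A polynomial in the target plane outside of whose zero set there are two inverse images. -/
def exceptional (p ρ : R) : R := p * (p + 1) * ρ * (ρ - 200 * p - 33) * tFactor p ρ

variable {S : Type*} [CommRing S] (φ : R →+* S) (p ρ : R)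

theorem map_numAt : φ (numAt p ρ) = numAt (φ p) (φ ρ) := by simp [numAt, map_ofNat]

theorem map_exceptional : φ (exceptional p ρ) = exceptional (φ p) (φ ρ) := by
  simp [exceptional, tFactor, map_ofNat]

end Exceptional

/-! ### Real solutions of `numAt p s = ρ s²` -/

section Roots

open Polynomial

/-- The polynomial `numAt p s` in the variable `s`. -/
noncomputable def numPoly (p : ℝ) : ℝ[X] := numAt (C p) X

theorem eval_numPoly (p s : ℝ) : (numPoly p).eval s = numAt p s := by
  have := map_numAt (evalRingHom s) (C p) X
  simpa [numPoly] using this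

/-- This is `s ∂r/∂s = 4J` multiplied by `s²`, with `s t` replaced by `s h - h²(h + 1)` and `h = p -
s`. -/
theorem mul_eval_derivative_numPoly (p s : ℝ) :
    s * (numPoly p).derivative.eval s - 2 * numAt p s =
      4 * ((s * (p - s) - (p - s) ^ 2 * (p - s + 1)) ^ 2
        + (s * (p - s) - (p - s) ^ 2 * (p - s + 1) + s ^ 2 * (13 + 15 * (p - s))) ^ 2 + s ^ 4) := by
  simp only [numPoly, numAt, derivative_add, derivative_sub, derivative_neg, derivative_mul,
    derivative_X, derivative_C, derivative_ofNat, derivative_pow,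
    eval_add, eval_sub, eval_neg, eval_mul, eval_pow, eval_X, eval_C, eval_ofNat,
    eval_zero, eval_one, derivative_one]
  push_cast
  ring

theorem hasDerivAt_numAt_div_sq (p : ℝ) {s : ℝ} (hs : s ≠ 0) :
    HasDerivAt (fun s => numAt p s / s ^ 2)
      (4 * ((s * (p - s) - (p - s) ^ 2 * (p - s + 1)) ^ 2
        + (s * (p - s) - (p - s) ^ 2 * (p - s + 1) + s ^ 2 * (13 + 15 * (p - s))) ^ 2 + s ^ 4)
        / s ^ 3) s := by
  have h1 := (numPoly p).hasDerivAt s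
  simp only [eval_numPoly] at h1
  have h2 := h1.fun_div (hasDerivAt_pow 2 s) (pow_ne_zero 2 hs)
  convert! h2 using 1
  rw [← mul_eval_derivative_numPoly]
  field_simp
  push_cast
  ring

theorem deriv_numerator_pos (p : ℝ) {s : ℝ} (hs : s ≠ 0) :
    0 < 4 * ((s * (p - s) - (p - s) ^ 2 * (p - s + 1)) ^ 2
        + (s * (p - s) - (p - s) ^ 2 * (p - s + 1) + s ^ 2 * (13 + 15 * (p - s))) ^ 2 + s ^ 4) := by
  positivity

theorem strictMonoOn_numAt_div_sq (p : ℝ) :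
    StrictMonoOn (fun s => numAt p s / s ^ 2) (Set.Ioi 0) := by
  refine strictMonoOn_of_deriv_pos (convex_Ioi 0) (fun s hs =>
    (hasDerivAt_numAt_div_sq p (ne_of_gt hs)).continuousAt.continuousWithinAt) fun s hs => ?_
  rw [interior_Ioi, Set.mem_Ioi] at hs
  rw [(hasDerivAt_numAt_div_sq p hs.ne').deriv]
  exact div_pos (deriv_numerator_pos p hs.ne') (pow_pos hs 3)

theorem strictAntiOn_numAt_div_sq (p : ℝ) :
    StrictAntiOn (fun s => numAt p s / s ^ 2) (Set.Iio 0) := by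
  refine strictAntiOn_of_deriv_neg (convex_Iio 0) (fun s hs =>
    (hasDerivAt_numAt_div_sq p (ne_of_lt hs)).continuousAt.continuousWithinAt) fun s hs => ?_
  rw [interior_Iio, Set.mem_Iio] at hs
  rw [(hasDerivAt_numAt_div_sq p hs.ne).deriv]
  exact div_neg_of_pos_of_neg (deriv_numerator_pos p hs.ne) (Odd.pow_neg (by decide) hs)

theorem exists_pos_sextic_pos (a₀ a₁ a₂ a₃ a₄ a₅ : ℝ) :
    ∃ s : ℝ, 0 < s ∧
      0 < a₀ + a₁ * s + a₂ * s ^ 2 + a₃ * s ^ 3 + a₄ * s ^ 4 + a₅ * s ^ 5 + 197 * s ^ 6 := by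
  set P : ℝ[X] := C a₀ + C a₁ * X + C a₂ * X ^ 2 + C a₃ * X ^ 3 + C a₄ * X ^ 4 + C a₅ * X ^ 5
    + C 197 * X ^ 6 with hP
  have hdeg : P.natDegree = 6 := by rw [hP]; compute_degree!
  have hlead : 0 ≤ P.leadingCoeff := by
    rw [leadingCoeff, hdeg, hP]
    simp
  have ht := P.tendsto_atTop_of_leadingCoeff_nonneg (by
    rw [← natDegree_pos_iff_degree_pos, hdeg]; norm_num) hlead
  obtain ⟨s, hs, hs'⟩ := ((Filter.eventually_gt_atTop 0).and (ht.eventually_gt_atTop 0)).exists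
  exact ⟨s, hs, by simpa [hP] using hs'⟩

theorem continuous_numAt_sub (p ρ : ℝ) : Continuous fun s => numAt p s - ρ * s ^ 2 := by
  unfold numAt
  fun_prop

theorem numAt_zero_neg {p : ℝ} (h0 : p ≠ 0) (h1 : p + 1 ≠ 0) (ρ : ℝ) :
    numAt p 0 - ρ * 0 ^ 2 < 0 := by
  have : 0 < p ^ 4 * (p + 1) ^ 2 := by positivity
  simp only [numAt]
  linarith

theorem exists_pos_root {p : ℝ} (h0 : p ≠ 0) (h1 : p + 1 ≠ 0) (ρ : ℝ) :
    ∃ s, 0 < s ∧ numAt p s = ρ * s ^ 2 := by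
  obtain ⟨S, hS, hS'⟩ := exists_pos_sextic_pos (-4 * p ^ 4 * (p + 1) ^ 2)
    (48 * p ^ 3 * (p + 1) ^ 2) (-(512 * p ^ 2 + 604 * p ^ 3 + 255 * p ^ 4) - ρ)
    (216 * p + 536 * p ^ 2 + 320 * p ^ 3) (252 + 396 * p + 150 * p ^ 2) (-(416 + 456 * p))
  have hneg := numAt_zero_neg h0 h1 ρ
  obtain ⟨s, hs, hs0⟩ := intermediate_value_Ioo hS.le (continuous_numAt_sub p ρ).continuousOn
    (show (0 : ℝ) ∈ Set.Ioo _ _ from ⟨hneg, by simp only [numAt]; linarith⟩)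
  exact ⟨s, hs.1, by linarith⟩

theorem exists_neg_root {p : ℝ} (h0 : p ≠ 0) (h1 : p + 1 ≠ 0) (ρ : ℝ) :
    ∃ s, s < 0 ∧ numAt p s = ρ * s ^ 2 := by
  -- The odd coefficients change sign because the sextic is evaluated at `-S`.
  obtain ⟨S, hS, hS'⟩ := exists_pos_sextic_pos (-4 * p ^ 4 * (p + 1) ^ 2)
    (-(48 * p ^ 3 * (p + 1) ^ 2)) (-(512 * p ^ 2 + 604 * p ^ 3 + 255 * p ^ 4) - ρ)
    (-(216 * p + 536 * p ^ 2 + 320 * p ^ 3)) (252 + 396 * p + 150 * p ^ 2) (416 + 456 * p)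
  have hneg := numAt_zero_neg h0 h1 ρ
  obtain ⟨s, hs, hs0⟩ := intermediate_value_Ioo' (neg_nonpos.2 hS.le)
    (continuous_numAt_sub p ρ).continuousOn
    (show (0 : ℝ) ∈ Set.Ioo _ _ from ⟨hneg, by simp only [numAt]; linarith⟩)
  exact ⟨s, hs.2, by linarith⟩

theorem exists_roots_eq_pair {p : ℝ} (h0 : p ≠ 0) (h1 : p + 1 ≠ 0) (ρ : ℝ) :
    ∃ a b, a ≠ b ∧ {s | s ≠ 0 ∧ numAt p s = ρ * s ^ 2} = {a, b} := by
  obtain ⟨a, ha, ha'⟩ := exists_pos_root h0 h1 ρ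
  obtain ⟨b, hb, hb'⟩ := exists_neg_root h0 h1 ρ
  refine ⟨a, b, (hb.trans ha).ne', ?_⟩
  ext s
  simp only [Set.mem_ofPred_eq, Set.mem_insert_iff, Set.mem_singleton_iff]
  have hdiv {c : ℝ} (hc : c ≠ 0) (h : numAt p c = ρ * c ^ 2) : numAt p c / c ^ 2 = ρ := by
    rw [h]; field_simp
  constructor
  · rintro ⟨hs, hs'⟩
    rcases lt_or_gt_of_ne hs with hlt | hgt
    · right
      exact (strictAntiOn_numAt_div_sq p).injOn hlt hb ((hdiv hs hs').trans (hdiv hb.ne hb').symm)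
    · left
      exact (strictMonoOn_numAt_div_sq p).injOn hgt ha ((hdiv hs hs').trans (hdiv ha.ne' ha').symm)
  · rintro (rfl | rfl)
    exacts [⟨ha.ne', ha'⟩, ⟨hb.ne, hb'⟩]

end Roots

/-! ### Points of a fibre and roots of the sextic -/

section Fiber

variable {K : Type*} [Field K] {p ρ : K}

theorem exceptional_ne_zero_iff : exceptional p ρ ≠ 0 ↔
    p ≠ 0 ∧ p + 1 ≠ 0 ∧ ρ ≠ 0 ∧ ρ - 200 * p - 33 ≠ 0 ∧ tFactor p ρ ≠ 0 := by
  simp only [exceptional, mul_ne_zero_iff, and_assoc]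

theorem ne_zero_of_exceptional_ne_zero (hg : exceptional p ρ ≠ 0) {x y : K} (hp : pAt x y = p)
    (hρ : rAt x y = ρ) : fAt x y ≠ 0 ∧ tAt x y ≠ 0 ∧ x ≠ 0 := by
  obtain ⟨h1, h2, h3, h4, -⟩ := exceptional_ne_zero_iff.1 hg
  refine ⟨fun hf => ?_, fun ht => h3 ?_, fun hx => h4 ?_⟩
  · have h := fAt_mul_hAt_sub_tAt x y
    have hh : hAt x y = p := by rw [← hp, pAt, hf, zero_add]
    rw [hf, zero_mul, hh] at h
    exact mul_ne_zero (pow_ne_zero 2 h1) h2 h.symm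
  · have hh : hAt x y = 0 := by rw [hAt, ht, zero_mul]
    rw [← hρ, rAt, hh, ht, fourU]
    ring
  · have ht : tAt x y = -1 := by rw [tAt, hx]; ring
    have hh : hAt x y = -1 := by rw [hAt, ht, hx]; ring
    have hf : fAt x y = p + 1 := by rw [← hp, pAt, hh]; ring
    rw [← hρ, rAt, hh, ht, hf, fourU]
    ring

/-- Off the exceptional curve `f`, `t` and `x` are nonzero on the fibre, so the divisions recovering
`t`, `x` and `y` from `p` and `f` are legitimate. -/
theorem injOn_fAt (hg : exceptional p ρ ≠ 0) :
    Set.InjOn (fun v : Fin 2 → K => fAt (v 0) (v 1))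
      {v | pAt (v 0) (v 1) = p ∧ rAt (v 0) (v 1) = ρ} := by
  rintro v ⟨hv, hv'⟩ w ⟨hw, hw'⟩ (hvw : fAt (v 0) (v 1) = fAt (w 0) (w 1))
  obtain ⟨hf, ht, hx⟩ := ne_zero_of_exceptional_ne_zero hg hv hv'
  have hh : hAt (v 0) (v 1) = hAt (w 0) (w 1) := by
    have := hv.trans hw.symm
    rw [pAt, pAt, hvw] at this
    exact add_left_cancel this
  have htt : tAt (v 0) (v 1) = tAt (w 0) (w 1) := by
    have e1 := fAt_mul_hAt_sub_tAt (v 0) (v 1)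
    have e2 := fAt_mul_hAt_sub_tAt (w 0) (w 1)
    rw [← hvw, ← hh, ← e1] at e2
    have := mul_left_cancel₀ hf e2
    linear_combination this
  have hxx : v 0 = w 0 := by
    have e1 := mul_tAt_sq (v 0) (v 1)
    have e2 := mul_tAt_sq (w 0) (w 1)
    rw [← htt, ← hh, ← e1] at e2
    exact (mul_right_cancel₀ (pow_ne_zero 2 ht) e2).symm
  have hyy : v 1 = w 1 := by
    have e1 := mul_eq_tAt_add_one (v 0) (v 1)
    have e2 := mul_eq_tAt_add_one (w 0) (w 1)
    rw [← htt, ← hxx, ← e1] at e2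
    exact (mul_left_cancel₀ hx e2).symm
  ext i
  fin_cases i
  exacts [hxx, hyy]

/-- The point is built by solving the relations for `τ`, then `x`, then `y`; the factors of
`exceptional` guarantee `τ ≠ 0` and `x ≠ 0`. -/
theorem exists_point_of_root (hg : exceptional p ρ ≠ 0) {s : K} (hs : s ≠ 0)
    (hroot : numAt p s = ρ * s ^ 2) : ∃ x y : K, fAt x y = s ∧ pAt x y = p ∧ rAt x y = ρ := by
  obtain ⟨-, -, h3, h4, h5⟩ := exceptional_ne_zero_iff.1 hg
  have hval {τ : K} (hτ : s * (p - s - τ) = (p - s) ^ 2 * (p - s + 1)) :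
      4 * (-τ ^ 2 - 6 * τ * (p - s) * (p - s + 1)) - fourU s (p - s) = ρ :=
    mul_right_cancel₀ (pow_ne_zero 2 hs) ((mul_sq_eq_numAt hτ).trans hroot)
  have hh0 : p - s ≠ 0 := by
    intro h
    apply h3
    rw [← hval (τ := 0) (by rw [h]; ring), h, fourU]
    ring
  have hh1 : p - s + 1 ≠ 0 := by
    intro h
    apply h4
    have e : p = s - 1 := by linear_combination h
    subst e
    rw [← hval (τ := -1) (by ring), fourU]
    ring
  obtain ⟨τ, hτ⟩ : ∃ τ, s * (p - s - τ) = (p - s) ^ 2 * (p - s + 1) :=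
    ⟨p - s - (p - s) ^ 2 * (p - s + 1) / s, by field_simp; ring⟩
  -- If `τ = 0`, then with `η = p - s` one gets `p = η² + 2η` and `ρ = 45p² + 208p - (300p² + 716p +
  -- 416)η`. Eliminating `η` gives `tFactor p ρ = 0`.
  have hτ0 : τ ≠ 0 := by
    rintro rfl
    apply h5
    obtain ⟨η, rfl⟩ : ∃ η, p = η + s := ⟨p - s, by ring⟩
    have hη : η ≠ 0 := by simpa using hh0
    have e : s = η * (η + 1) := by
      apply mul_right_cancel₀ hη
      linear_combination hτ
    subst e
    rw [← hval hτ, tFactor, fourU]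
    ring
  have hhτ : p - s - τ ≠ 0 := by
    intro h
    rw [h, mul_zero] at hτ
    exact mul_ne_zero (pow_ne_zero 2 hh0) hh1 hτ.symm
  set x : K := (p - s - τ) / τ ^ 2 with hx
  have hx0 : x ≠ 0 := div_ne_zero hhτ (pow_ne_zero 2 hτ0)
  have hxτ : x * τ ^ 2 = p - s - τ := by rw [hx]; field_simp
  have ht : tAt x ((τ + 1) / x) = τ := by rw [tAt]; field_simp; ring
  have hh : hAt x ((τ + 1) / x) = p - s := by
    rw [hAt, ht]; linear_combination hxτ
  have hf : fAt x ((τ + 1) / x) = s := by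
    have := fAt_mul_hAt_sub_tAt x ((τ + 1) / x)
    rw [hh, ht, ← hτ] at this
    exact mul_right_cancel₀ hhτ this
  refine ⟨x, (τ + 1) / x, hf, by rw [pAt, hf, hh]; ring, ?_⟩
  rw [rAt, hf, hh, ht, hval hτ]

theorem image_fAt (hg : exceptional p ρ ≠ 0) :
    (fun v : Fin 2 → K => fAt (v 0) (v 1)) '' {v | pAt (v 0) (v 1) = p ∧ rAt (v 0) (v 1) = ρ} =
      {s | s ≠ 0 ∧ numAt p s = ρ * s ^ 2} := by
  ext s
  constructor
  · rintro ⟨v, ⟨hv, hv'⟩, rfl⟩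
    refine ⟨(ne_zero_of_exceptional_ne_zero hg hv hv').1, ?_⟩
    dsimp only
    rw [← hv', rAt_mul_sq, hv]
  · rintro ⟨hs, hroot⟩
    obtain ⟨x, y, hf, hp, hr⟩ := exists_point_of_root hg hs hroot
    exact ⟨![x, y], ⟨by simpa using hp, by simpa using hr⟩, by simpa using hf⟩

end Fiber

theorem ncard_fiber {p ρ : ℝ} (hg : exceptional p ρ ≠ 0) :
    {v : Fin 2 → ℝ | pAt (v 0) (v 1) = p ∧ rAt (v 0) (v 1) = ρ}.ncard = 2 := by
  obtain ⟨h1, h2, -⟩ := exceptional_ne_zero_iff.1 hg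
  obtain ⟨a, b, hab, heq⟩ := exists_roots_eq_pair h1 h2 ρ
  rw [← (injOn_fAt hg).ncard_image, image_fAt hg, heq, Set.ncard_pair hab]

open MvPolynomial in
theorem genericallyTwoToOne_of_isPinchukMap {F : Fin 2 → MvPolynomial (Fin 2) ℝ}
    (hF : IsPinchukMap F) : GenericallyTwoToOne F := by
  obtain ⟨u, hu⟩ := exists_polynomial_of_isPinchukMap hF
  have heval (w : Fin 2 → ℝ) : eval w (exceptional (X 0) (4 * X 1 - Polynomial.aeval (X 0) u)) =
      exceptional (w 0) (4 * w 1 - u.eval (w 0)) := by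
    rw [map_exceptional, map_sub, map_mul, map_ofNat, eval_X, eval_X,
      ← MvPolynomial.coe_aeval_eq_eval, RingHom.coe_coe, ← Polynomial.aeval_algHom_apply, aeval_X,
      Polynomial.coe_aeval_eq_eval]
  refine ⟨exceptional (X 0) (4 * X 1 - Polynomial.aeval (X 0) u), fun h => ?_, fun w hw => ?_⟩
  -- At `p = 1` the value `ρ = 253 = 45 + 208` kills the shifted variable in `tFactor`, leaving
  -- `-1432²`; the other factors are visibly nonzero.
  · have h1 := heval ![1, (253 + u.eval 1) / 4]
    rw [h, map_zero, Matrix.cons_val_zero, Matrix.cons_val_one, Matrix.cons_val_fin_one,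
      mul_div_cancel₀ _ (by norm_num : (4 : ℝ) ≠ 0), add_sub_cancel_right] at h1
    norm_num [exceptional, tFactor] at h1
  · rw [heval] at hw
    refine (congrArg Set.ncard ?_).trans (ncard_fiber hw)
    ext v
    have hP : polyMap F v 0 = pAt (v 0) (v 1) := by
      rw [polyMap, hF.fst_eq, f_add_h_eq, pPoly, map_pAt, eval_X, eval_X]
    have hQ : 4 * polyMap F v 1 = rAt (v 0) (v 1) + u.eval (polyMap F v 0) := by
      have := congrArg (eval v) hu
      rw [map_mul, map_ofNat, map_add, rPoly, map_rAt, eval_X, eval_X,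
        ← MvPolynomial.coe_aeval_eq_eval, RingHom.coe_coe, ← Polynomial.aeval_algHom_apply,
        Polynomial.coe_aeval_eq_eval, ← f_add_h_eq, ← hF.fst_eq] at this
      exact this
    simp only [Set.mem_ofPred_eq]
    constructor
    · rintro rfl
      exact ⟨hP.symm, by linear_combination -hQ⟩
    · rintro ⟨h1, h2⟩
      ext i
      fin_cases i
      · exact hP.trans h1
      · rw [hP.trans h1, h2] at hQ
        change polyMap F v 1 = w 1
        linear_combination hQ / 4

end Pinchuk

theorem mainTheorem1 (F : Fin 2 → MvPolynomial (Fin 2) ℝ) (hF : Pinchuk.IsPinchukMap F) :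
    Pinchuk.GenericallyTwoToOne F ∧
    ∀ (k : Subfield ℝ) (hk : Pinchuk.DefinedOver k F),
      Module.finrank (Pinchuk.componentField hk) (Pinchuk.FunctionField k) = 6 ∧
      (∀ σ : Pinchuk.FunctionField k ≃ₐ[Pinchuk.componentField hk] Pinchuk.FunctionField k,
        σ = AlgEquiv.refl) ∧
      ¬ IsGalois (Pinchuk.componentField hk) (Pinchuk.FunctionField k) :=
  ⟨Pinchuk.genericallyTwoToOne_of_isPinchukMap hF, fun _ hk =>
    ⟨Pinchuk.finrank_componentField hF hk, Pinchuk.algEquiv_componentField_eq_refl hF hk,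
      Pinchuk.not_isGalois_componentField hF hk⟩⟩
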